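/- For positive integers $s_1,\dots,s_r$ with $s_1>1$ let $$\zeta^\star(s_1,\dots,s_r)=\sum_{k_1\ge\cdots\ge k_r\ge 1}\frac{1}{k_1^{s_1}\cdots k_r^{s_r}},\qquad \zeta^\star(\emptyset)=1,$$ and let $\{2\}^a$ denote the string $2,\dots,2$ of length $a$. For integers $d\ge 0$, $n\ge 0$ put $$Z_0^\star(d,n)=\sum_{\substack{a_1,\dots,a_{2d}\ge 0\\ a_1+\cdots+a_{2d}=n}}\zeta^\star(\{2\}^{a_1},3,\{2\}^{a_2},1,\dots,3,\{2\}^{a_{2d}},1),$$ and for $d\ge 0$, $n\ge 1$ $$Z_1^\star(d,n)=\sum_{\substack{a_1,\dots,a_{2d+1}\ge 0\\ a_1+\cdots+a_{2d+1}=n-1}}\zeta^\star(\{2\}^{a_1},3,\{2\}^{a_2},1,\dots,3,\{2\}^{a_{2d}},1,\{2\}^{a_{2d+1}+1}).$$ Let $z,w\in\mathbb{C}$ with $|z|<1$ and $|w|<1$. Then for every $d\ge 0$ the inner series (over $n$) below converge absolutely. If moreover $|w|^2<|1-z^2|$, then the two outer series (over $d$) converge absolutely as well, and $$\sum_{d=0}^{\infty}\sum_{n=0}^{\infty}Z_0^\star(d,n)\,z^{2n}w^{4d}-\sum_{d=0}^{\infty}\sum_{n=1}^{\infty}Z_1^\star(d,n)\,z^{2n-2}w^{4d+2}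 =\frac{\sqrt{z^2+w^2}}{\sqrt{z^2-w^2}}\,\tan\!\left(\frac{\pi\sqrt{z^2-w^2}}{2}\right)\cot\!\left(\frac{\pi\sqrt{z^2+w^2}}{2}\right).$$ Here the choice of the square roots is irrelevant, and the right-hand side is understood as its continuous extension where $z^2=w^2$ or $z^2=-w^2$: $\tan(\pi a/2)/a$ is read as $\pi/2$ at $a=0$, and $b\cot(\pi b/2)$ as $2/\pi$ at $b=0$. -/

import Mathlib

/-- The multiple zeta star value `ζ⋆(s₁, …, s_r)`: the sum of `k₁^(-s₁) ⋯ k_r^(-s_r)` over all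
positive integers `k₁ ≥ ⋯ ≥ k_r ≥ 1`. The empty index has value `1`. -/
noncomputable def zetaStar (s : List ℕ) : ℝ :=
  ∑' k : {k : Fin s.length → ℕ+ // Antitone k},
    ∏ i, (1 : ℝ) / ((k.1 i : ℕ) : ℝ) ^ (s.get i)

/-- The index `({2}^{a₁}, 3, {2}^{a₂}, 1, …, 3, {2}^{a_{2d}}, 1)`. -/
def index31 (d : ℕ) (a : Fin (2 * d) → ℕ) : List ℕ :=
  (List.ofFn fun j : Fin (2 * d) =>
    List.replicate (a j) 2 ++ [if (j : ℕ) % 2 = 0 then 3 else 1]).flatten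

/-- `Z⋆₀(d, n)`: the sum of `ζ⋆({2}^{a₁}, 3, {2}^{a₂}, 1, …, 3, {2}^{a_{2d}}, 1)` over
`a₁ + ⋯ + a_{2d} = n`. -/
noncomputable def Zstar0 (d n : ℕ) : ℝ :=
  ∑ a ∈ Finset.Nat.antidiagonalTuple (2 * d) n, zetaStar (index31 d a)

/-- `Z⋆₁(d, n)`: the sum of
`ζ⋆({2}^{a₁}, 3, {2}^{a₂}, 1, …, 3, {2}^{a_{2d}}, 1, {2}^{a_{2d+1} + 1})` over
`a₁ + ⋯ + a_{2d+1} = n - 1` (an empty sum for `n = 0`). -/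
noncomputable def Zstar1 (d : ℕ) : ℕ → ℝ
  | 0 => 0
  | n + 1 => ∑ a ∈ Finset.Nat.antidiagonalTuple (2 * d + 1) n,
      zetaStar (index31 d (fun j => a j.castSucc) ++ List.replicate (a (Fin.last (2 * d)) + 1) 2)

/-- `tan (π a / 2) / a`, extended by its limit `π / 2` at `a = 0`. -/
noncomputable def tanQuot (a : ℂ) : ℂ :=
  if a = 0 then (Real.pi : ℂ) / 2 else Complex.tan (Real.pi * a / 2) / a

/-- `b * cot (π b / 2)`, extended by its limit `2 / π` at `b = 0`. -/
noncomputable def cotProd (b : ℂ) : ℂ :=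
  if b = 0 then 2 / (Real.pi : ℂ) else b * Complex.cot (Real.pi * b / 2)

/-!
Sort the words by the number `m` of their blocks `({2}^a, c)`, where `c` is `3` and `1` in turn and
a final `3` is read as `2`. Marking the blocks by `W = -w ^ 2` and the remaining letters `2` by
`Z = z ^ 2`, the even `m` contribute `Zstar0` and the odd ones `-Zstar1`.

Truncated to `k₁ ≤ N`, the generating functions of the words whose first block is closed by `3`,
respectively by `1`, satisfy a linear two-term recursion in `N`. It is solved explicitly by
weighting the increments of the partial products of
`∏_{k ≥ 1} (k² - Z - (-1)^k W) / (k² - Z + (-1)^k W)` with the connectors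
`N!² / ((N - k)! (N + k)!)`. These tend to `1` as `N → ∞`, so the full generating function is the
infinite product, which Euler's products for sine and cosine evaluate.

The double series is dominated only for `‖Z‖ + ‖W‖ < 1`; since the product is holomorphic in `W` on
`‖W‖ < ‖1 - Z‖`, uniqueness of its Taylor series at `W = 0` gives the identity on that disc.
-/

open Filter Finset Topology

section TruncatedSums

/-- The antitone `r`-tuples of positive integers with entries at most `N`. -/
def antitoneTuples (r N : ℕ) : Finset (Fin r → ℕ+) :=
  {k ∈ Fintype.piFinset fun _ => Ico 1 N.succPNat | Antitone k}

theorem mem_antitoneTuples {r N : ℕ} {k : Fin r → ℕ+} :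
    k ∈ antitoneTuples r N ↔ (∀ i, (k i : ℕ) ≤ N) ∧ Antitone k := by
  simp [antitoneTuples, ← PNat.coe_lt_coe]

theorem antitoneTuples_mono (r : ℕ) : Monotone (antitoneTuples r) := fun _ _ h _ hk =>
  mem_antitoneTuples.mpr
    ⟨fun i => ((mem_antitoneTuples.mp hk).1 i).trans h, (mem_antitoneTuples.mp hk).2⟩

theorem antitone_cons_iff {α : Type*} [Preorder α] {r : ℕ} {m : α} {k : Fin r → α} :
    Antitone (Fin.cons m k : Fin (r + 1) → α) ↔ (∀ i, k i ≤ m) ∧ Antitone k := by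
  constructor
  · intro h
    exact ⟨fun i => by simpa using h (Fin.zero_le i.succ),
      fun i j hij => by simpa using h (Fin.succ_le_succ_iff.mpr hij)⟩
  · rintro ⟨hm, hk⟩ i j hij
    cases j using Fin.cases with
    | zero => rw [Fin.le_zero_iff.mp hij]
    | succ j =>
      cases i using Fin.cases with
      | zero => simpa using hm j
      | succ i => simpa using hk (Fin.succ_le_succ_iff.mp hij)

theorem cons_mem_antitoneTuples {r N : ℕ} {m : ℕ+} {k : Fin r → ℕ+} :
    (Fin.cons m k : Fin (r + 1) → ℕ+) ∈ antitoneTuples (r + 1) N ↔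
      (m : ℕ) ≤ N ∧ k ∈ antitoneTuples r m := by
  simp only [mem_antitoneTuples, antitone_cons_iff, Fin.forall_fin_succ, Fin.cons_zero,
    Fin.cons_succ, PNat.coe_le_coe]
  exact ⟨fun h => ⟨h.1.1, h.2⟩,
    fun h => ⟨⟨h.1, fun i => (PNat.coe_le_coe _ _ |>.mpr (h.2.1 i)).trans h.1⟩, h.2⟩⟩

theorem sum_antitoneTuples_succ {M : Type*} [AddCommMonoid M] (r N : ℕ)
    (f : (Fin (r + 1) → ℕ+) → M) :
    ∑ k ∈ antitoneTuples (r + 1) N, f k =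
      ∑ m ∈ range N, ∑ k ∈ antitoneTuples r (m + 1), f (Fin.cons m.succPNat k) := by
  rw [sum_sigma']
  refine (sum_bij' (fun x _ => Fin.cons x.1.succPNat x.2)
    (fun k _ => ⟨(k 0).natPred, Fin.tail k⟩) ?_ ?_ ?_ ?_ fun _ _ => rfl).symm
  · rintro ⟨m, k⟩ h
    rw [mem_sigma, mem_range] at h
    exact cons_mem_antitoneTuples.mpr h
  · intro k h
    rw [← Fin.cons_self_tail k, cons_mem_antitoneTuples] at h
    rw [mem_sigma, mem_range, ← Nat.add_one_le_iff, PNat.natPred_add_one]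
    exact h
  · intro _ _
    simp
  · intro k _
    simp

/-- The truncation of the series `zetaStar l` to the tuples with entries at most `N`. -/
noncomputable def starSum (l : List ℕ) (N : ℕ) : ℝ :=
  ∑ k ∈ antitoneTuples l.length N, ∏ i, 1 / ((k i : ℕ) : ℝ) ^ l.get i

theorem starSum_nonneg (l : List ℕ) (N : ℕ) : 0 ≤ starSum l N :=
  sum_nonneg fun _ _ => prod_nonneg fun _ _ => by positivity

theorem starSum_nil (N : ℕ) : starSum [] N = 1 := by
  have h : antitoneTuples 0 N = {Fin.elim0} := by
    ext k
    simp [mem_antitoneTuples, Antitone, Subsingleton.elim k Fin.elim0]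
  simp [starSum, h]

theorem starSum_cons (s : ℕ) (l : List ℕ) (N : ℕ) :
    starSum (s :: l) N = ∑ m ∈ range N, starSum l (m + 1) / ((m : ℝ) + 1) ^ s := by
  refine (sum_antitoneTuples_succ l.length N _).trans (sum_congr rfl fun m _ => ?_)
  rw [starSum, sum_div]
  refine sum_congr rfl fun k _ => (Fin.prod_univ_succ _).trans ?_
  simp [div_eq_inv_mul]

theorem starSum_cons_zero (s : ℕ) (l : List ℕ) : starSum (s :: l) 0 = 0 := by
  rw [starSum_cons, range_zero, sum_empty]

theorem starSum_cons_succ (s : ℕ) (l : List ℕ) (N : ℕ) :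
    starSum (s :: l) (N + 1) = starSum (s :: l) N + starSum l (N + 1) / ((N : ℝ) + 1) ^ s := by
  rw [starSum_cons, starSum_cons, sum_range_succ]

theorem tendsto_starSum {l : List ℕ} {C : ℝ} (hC : ∀ N, starSum l N ≤ C) :
    Tendsto (starSum l) atTop (𝓝 (zetaStar l)) := by
  set f : {k : Fin l.length → ℕ+ // Antitone k} → ℝ := fun k => ∏ i, 1 / ((k.1 i : ℕ) : ℝ) ^ l.get i
  set t : ℕ → Finset {k : Fin l.length → ℕ+ // Antitone k} :=
    fun N => (antitoneTuples l.length N).subtype Antitone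
  have hf : 0 ≤ f := fun k => prod_nonneg fun _ _ => by positivity
  have sum_t : ∀ N, ∑ k ∈ t N, f k = starSum l N := fun N =>
    sum_subtype_of_mem (fun k : Fin l.length → ℕ+ => ∏ i, 1 / ((k i : ℕ) : ℝ) ^ l.get i)
      fun k hk => (mem_antitoneTuples.mp hk).2
  have t_mono : Monotone t := fun _ _ h => subtype_mono (antitoneTuples_mono _ h)
  have t_exhausts : ∀ k, ∃ N, k ∈ t N := fun k =>
    ⟨∑ i, (k.1 i : ℕ), mem_subtype.mpr (mem_antitoneTuples.mpr
      ⟨fun i => single_le_sum (f := fun i => (k.1 i : ℕ)) (fun _ _ => zero_le) (mem_univ i), k.2⟩)⟩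
  have ht := tendsto_atTop_finset_of_monotone t_mono t_exhausts
  have hsum : Summable f := summable_of_sum_le hf fun u => by
    obtain ⟨N, hN⟩ := (ht.eventually_ge_atTop u).exists
    exact (sum_le_sum_of_subset_of_nonneg hN fun k _ _ => hf k).trans ((sum_t N).trans_le (hC N))
  exact (hsum.hasSum.comp ht).congr sum_t

end TruncatedSums

section Words

/-- The letter that closes a block of `2`s, where `b` says whether it is the `3` or the `1` of an
alternating word and `m` counts the blocks after it. A `3` without its `1` is read as `2`: this
turns the tail `{2}^{a_{2d+1} + 1}` in `Zstar1` into a block like the others. -/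
def closingLetter (b : Bool) (m : ℕ) : ℕ :=
  if b then (if m = 0 then 2 else 3) else 1

/-- The word `({2}^{a₁}, c₁, …, {2}^{a_m}, c_m)` whose closing letters alternate between `3` and
`1`, starting with `3` if `b` is true and with `1` otherwise, and where a final `3` is replaced by
`2`. -/
def word : Bool → (m : ℕ) → (Fin m → ℕ) → List ℕ
  | _, 0, _ => []
  | b, m + 1, a => List.replicate (a 0) 2 ++ closingLetter b m :: word (!b) m (Fin.tail a)

theorem word_cons (b : Bool) (m c : ℕ) (a : Fin m → ℕ) :
    word b (m + 1) (Fin.cons c a) = List.replicate c 2 ++ closingLetter b m :: word (!b) m a := by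
  simp [word]

theorem index31_succ (d : ℕ) (a : Fin (2 * (d + 1)) → ℕ) :
    index31 (d + 1) a =
      List.replicate (a 0) 2 ++ 3 :: (List.replicate (a 1) 2 ++ 1 ::
        index31 d (Fin.tail (Fin.tail a))) := by
  simp [index31, List.ofFn_succ, show 2 * (d + 1) = 2 * d + 2 from rfl, Fin.tail, add_assoc]

theorem word_two_mul (d : ℕ) (a : Fin (2 * d) → ℕ) : word true (2 * d) a = index31 d a := by
  induction d with
  | zero => simp [word, index31]
  | succ d ih =>
    rw [index31_succ, ← ih]
    rfl

theorem word_two_mul_add_one (d : ℕ) (a : Fin (2 * d + 1) → ℕ) :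
    word true (2 * d + 1) a =
      index31 d (fun j => a j.castSucc) ++ List.replicate (a (Fin.last (2 * d)) + 1) 2 := by
  induction d with
  | zero => simp [word, index31, closingLetter, List.replicate_succ']
  | succ d ih =>
    rw [index31_succ]
    refine (congrArg (fun l => List.replicate (a 0) 2 ++ 3 :: (List.replicate (a 1) 2 ++ 1 :: l))
      (ih (Fin.tail (Fin.tail a)))).trans ?_
    simp only [List.append_assoc, List.cons_append]
    rfl

end Words

section BlockSums

theorem sum_antidiagonalTuple_succ {M : Type*} [AddCommMonoid M] (m n : ℕ)
    (f : (Fin (m + 1) → ℕ) → M) :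
    ∑ a ∈ Nat.antidiagonalTuple (m + 1) n, f a =
      ∑ p ∈ antidiagonal n, ∑ a ∈ Nat.antidiagonalTuple m p.2, f (Fin.cons p.1 a) := by
  rw [sum_sigma']
  refine (sum_bij' (fun x _ => Fin.cons x.1.1 x.2)
    (fun a _ => ⟨(a 0, ∑ i, Fin.tail a i), Fin.tail a⟩) ?_ ?_ ?_ ?_ fun _ _ => rfl).symm
  · rintro ⟨⟨c, n'⟩, a⟩ h
    simp only [mem_sigma, HasAntidiagonal.mem_antidiagonal, Nat.mem_antidiagonalTuple] at h
    simp [Nat.mem_antidiagonalTuple, Fin.sum_univ_succ, h]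
  · intro a h
    rw [Nat.mem_antidiagonalTuple, Fin.sum_univ_succ] at h
    simp [Nat.mem_antidiagonalTuple, Fin.tail, h]
  · rintro ⟨⟨c, n'⟩, a⟩ h
    simp only [mem_sigma, Nat.mem_antidiagonalTuple] at h
    simp [h]
  · intro a _
    simp

/-- The sum of `zetaStar` over the words with `m` blocks, the first closed by a `3`, and `n` letters
`2` before the closing letters. -/
noncomputable def zetaSum (m n : ℕ) : ℝ :=
  ∑ a ∈ Nat.antidiagonalTuple m n, zetaStar (word true m a)

theorem zetaSum_two_mul (d n : ℕ) : zetaSum (2 * d) n = Zstar0 d n := by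
  simp only [zetaSum, Zstar0, word_two_mul]

theorem zetaSum_two_mul_add_one (d n : ℕ) : zetaSum (2 * d + 1) n = Zstar1 d (n + 1) := by
  simp only [zetaSum, Zstar1, word_two_mul_add_one]

/-- The truncation of `zetaSum` to summation indices at most `N`, with the first block closed by a
`3` or a `1` according to `b`. -/
noncomputable def blockSum (b : Bool) (m n N : ℕ) : ℝ :=
  ∑ a ∈ Nat.antidiagonalTuple m n, starSum (word b m a) N

theorem blockSum_nonneg (b : Bool) (m n N : ℕ) : 0 ≤ blockSum b m n N :=
  sum_nonneg fun _ _ => starSum_nonneg _ _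

theorem blockSum_zero_zero (b : Bool) (N : ℕ) : blockSum b 0 0 N = 1 := by
  simp [blockSum, word, starSum_nil]

theorem blockSum_zero_succ (b : Bool) (n N : ℕ) : blockSum b 0 (n + 1) N = 0 := by
  simp [blockSum]

theorem blockSum_succ_trunc_zero (b : Bool) (m n : ℕ) : blockSum b (m + 1) n 0 = 0 :=
  sum_eq_zero fun a _ => by cases h : a 0 <;> simp [word, h, List.replicate_succ, starSum_cons_zero]

theorem blockSum_succ_zero_trunc_succ (b : Bool) (m N : ℕ) :
    blockSum b (m + 1) 0 (N + 1) = blockSum b (m + 1) 0 N +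
      blockSum (!b) m 0 (N + 1) / ((N : ℝ) + 1) ^ closingLetter b m := by
  simp [blockSum, sum_antidiagonalTuple_succ, word_cons, starSum_cons_succ, sum_add_distrib,
    sum_div]

theorem blockSum_succ_succ_trunc_succ (b : Bool) (m n N : ℕ) :
    blockSum b (m + 1) (n + 1) (N + 1) = blockSum b (m + 1) (n + 1) N +
      blockSum b (m + 1) n (N + 1) / ((N : ℝ) + 1) ^ 2 +
      blockSum (!b) m (n + 1) (N + 1) / ((N : ℝ) + 1) ^ closingLetter b m := by
  simp only [blockSum, sum_antidiagonalTuple_succ, word_cons, Nat.sum_antidiagonal_succ,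
    List.replicate_zero, List.nil_append, List.replicate_succ, List.cons_append,
    starSum_cons_succ, sum_add_distrib, sum_div]
  ring

end BlockSums

section Majorant

/-- A supersolution of `P (N + 1) - P N = ρ / (N + 1) ^ 2 * P (N + 1)` with `P 0 = 1` that stays
bounded in `N` for every `ρ < 1`. -/
noncomputable def ratMajorant (ρ : ℝ) (N : ℕ) : ℝ := ((1 + ρ) - 2 * ρ / (N + 1)) / (1 - ρ)

variable {ρ : ℝ}

theorem one_le_ratMajorant (h0 : 0 ≤ ρ) (h1 : ρ < 1) (N : ℕ) : 1 ≤ ratMajorant ρ N := by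
  rw [ratMajorant, le_div_iff₀ (sub_pos.mpr h1)]
  have : 2 * ρ / (N + 1) ≤ 2 * ρ := div_le_self (by positivity) (by simp)
  linarith

theorem ratMajorant_le (h0 : 0 ≤ ρ) (h1 : ρ < 1) (N : ℕ) :
    ratMajorant ρ N ≤ (1 + ρ) / (1 - ρ) :=
  div_le_div_of_nonneg_right (sub_le_self _ (by positivity)) (sub_pos.mpr h1).le

theorem ratMajorant_add_le (h0 : 0 ≤ ρ) (h1 : ρ < 1) (N : ℕ) :
    ratMajorant ρ N + ρ / ((N : ℝ) + 1) ^ 2 * ratMajorant ρ (N + 1) ≤ ratMajorant ρ (N + 1) := by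
  have h : 0 < 1 - ρ := sub_pos.mpr h1
  have key : ratMajorant ρ (N + 1) - ratMajorant ρ N -
      ρ / ((N : ℝ) + 1) ^ 2 * ratMajorant ρ (N + 1) = ρ * N / ((N + 1) ^ 2 * (N + 2)) := by
    simp only [ratMajorant, Nat.cast_add, Nat.cast_one]
    field_simp
    ring
  have : 0 ≤ ρ * N / (((N : ℝ) + 1) ^ 2 * (N + 2)) := by positivity
  linarith

/-- The majorant of `blockSum b m n N * t ^ m * r ^ n` for `ρ = r + t`. The sums over words starting
with `1` diverge as `N → ∞`, which the factor `N` accommodates. -/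
noncomputable def blockMajorant (ρ : ℝ) : Bool → ℕ → ℕ → ℝ
  | true, _, N => ratMajorant ρ N
  | false, 0, _ => 1
  | false, _ + 1, N => N * ratMajorant ρ N

theorem blockMajorant_nonneg (h0 : 0 ≤ ρ) (h1 : ρ < 1) (b : Bool) (m N : ℕ) :
    0 ≤ blockMajorant ρ b m N := by
  have := one_le_ratMajorant h0 h1 N
  rcases b with _ | _ <;> rcases m with _ | m <;> simp only [blockMajorant] <;> positivity

theorem one_le_blockMajorant_zero (h0 : 0 ≤ ρ) (h1 : ρ < 1) (b : Bool) (N : ℕ) :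
    1 ≤ blockMajorant ρ b 0 N := by
  cases b
  · exact le_rfl
  · exact one_le_ratMajorant h0 h1 N

theorem blockMajorant_le (h0 : 0 ≤ ρ) (h1 : ρ < 1) (b : Bool) (m N : ℕ) :
    blockMajorant ρ b m N ≤ (N + 1) * ratMajorant ρ N := by
  have := one_le_ratMajorant h0 h1 N
  rcases b with _ | _ <;> rcases m with _ | m <;> simp only [blockMajorant] <;> nlinarith

variable {r t : ℝ}

theorem blockMajorant_add_le (hr : 0 ≤ r) (ht : 0 ≤ t) (hrt : r + t < 1) (b : Bool) (m N : ℕ) :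
    blockMajorant (r + t) b (m + 1) N +
        r / ((N : ℝ) + 1) ^ 2 * blockMajorant (r + t) b (m + 1) (N + 1) +
        t / ((N : ℝ) + 1) ^ closingLetter b m * blockMajorant (r + t) (!b) m (N + 1) ≤
      blockMajorant (r + t) b (m + 1) (N + 1) := by
  have h0 := add_nonneg hr ht
  have hstep := ratMajorant_add_le h0 hrt N
  have hone := one_le_ratMajorant h0 hrt (N + 1)
  cases b
  · have := mul_le_mul_of_nonneg_left hstep (by positivity : (0 : ℝ) ≤ N + 1)
    have := one_le_ratMajorant h0 hrt N
    simp only [blockMajorant, closingLetter, Bool.not_false, Bool.false_eq_true, if_false]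
    calc _ = N * ratMajorant (r + t) N + (N + 1) * ((r + t) / (N + 1) ^ 2 *
          ratMajorant (r + t) (N + 1)) := by
          push_cast
          field_simp
          ring
      _ ≤ _ := by
          push_cast
          linarith
  · refine le_trans ?_ hstep
    rw [add_div, add_mul, ← add_assoc]
    refine add_le_add_right ?_ _
    cases m
    · simp only [blockMajorant, closingLetter, Bool.not_true, if_true]
      gcongr
    · simp only [blockMajorant, closingLetter, Bool.not_true, if_true, Nat.succ_ne_zero, if_false]
      push_cast
      exact le_of_eq (by field_simp)

theorem blockSum_zero_mul_le (hr : 0 ≤ r) (ht : 0 ≤ t) (hrt : r + t < 1) (b : Bool) (m N : ℕ) :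
    blockSum b m 0 N * t ^ m ≤ blockMajorant (r + t) b m N := by
  have h0 := add_nonneg hr ht
  induction m generalizing b N with
  | zero => simpa [blockSum_zero_zero] using one_le_blockMajorant_zero h0 hrt b N
  | succ m ihm =>
    induction N with
    | zero => simpa [blockSum_succ_trunc_zero] using blockMajorant_nonneg h0 hrt b (m + 1) 0
    | succ N ihN =>
      have hr_term : 0 ≤ r / ((N : ℝ) + 1) ^ 2 * blockMajorant (r + t) b (m + 1) (N + 1) :=
        mul_nonneg (by positivity) (blockMajorant_nonneg h0 hrt _ _ _)
      calc _ = blockSum b (m + 1) 0 N * t ^ (m + 1) +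
            t / ((N : ℝ) + 1) ^ closingLetter b m * (blockSum (!b) m 0 (N + 1) * t ^ m) := by
            rw [blockSum_succ_zero_trunc_succ]
            ring
        _ ≤ blockMajorant (r + t) b (m + 1) N +
            t / ((N : ℝ) + 1) ^ closingLetter b m * blockMajorant (r + t) (!b) m (N + 1) := by
            gcongr
            exact ihm _ _
        _ ≤ _ := by linarith [blockMajorant_add_le hr ht hrt b m N]

theorem blockSum_mul_le (hr : 0 ≤ r) (ht : 0 ≤ t) (hrt : r + t < 1) (b : Bool) (m n N : ℕ) :
    blockSum b m n N * t ^ m * r ^ n ≤ blockMajorant (r + t) b m N := by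
  have h0 := add_nonneg hr ht
  induction n generalizing b m N with
  | zero => simpa using blockSum_zero_mul_le hr ht hrt b m N
  | succ n ihn =>
    induction m generalizing b N with
    | zero => simpa [blockSum_zero_succ] using blockMajorant_nonneg h0 hrt b 0 N
    | succ m ihm =>
      induction N with
      | zero => simpa [blockSum_succ_trunc_zero] using blockMajorant_nonneg h0 hrt b (m + 1) 0
      | succ N ihN =>
        calc _ = blockSum b (m + 1) (n + 1) N * t ^ (m + 1) * r ^ (n + 1) +
              r / ((N : ℝ) + 1) ^ 2 * (blockSum b (m + 1) n (N + 1) * t ^ (m + 1) * r ^ n) +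
              t / ((N : ℝ) + 1) ^ closingLetter b m *
                (blockSum (!b) m (n + 1) (N + 1) * t ^ m * r ^ (n + 1)) := by
              rw [blockSum_succ_succ_trunc_succ]
              ring
          _ ≤ _ := by
              refine le_trans ?_ (blockMajorant_add_le hr ht hrt b m N)
              gcongr
              · exact ihn _ _ _
              · exact ihm _ _

end Majorant

section Limits

theorem exists_blockSum_true_le (m n : ℕ) : ∃ C, ∀ N, blockSum true m n N ≤ C := by
  have hρ : (1 / 4 + 1 / 4 : ℝ) < 1 := by norm_num
  refine ⟨(1 + (1 / 4 + 1 / 4)) / (1 - (1 / 4 + 1 / 4)) / (1 / 4) ^ n / (1 / 4) ^ m, fun N => ?_⟩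
  rw [le_div_iff₀ (by positivity), le_div_iff₀ (by positivity)]
  exact (blockSum_mul_le (by norm_num) (by norm_num) hρ true m n N).trans
    (ratMajorant_le (by norm_num) hρ N)

theorem tendsto_blockSum (m n : ℕ) : Tendsto (blockSum true m n) atTop (𝓝 (zetaSum m n)) := by
  obtain ⟨C, hC⟩ := exists_blockSum_true_le m n
  refine tendsto_finsetSum _ fun a ha => tendsto_starSum (C := C) fun N => le_trans ?_ (hC N)
  exact single_le_sum (f := fun a => starSum (word true m a) N) (fun _ _ => starSum_nonneg _ _) ha

theorem zetaSum_nonneg (m n : ℕ) : 0 ≤ zetaSum m n :=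
  ge_of_tendsto' (tendsto_blockSum m n) fun N => blockSum_nonneg true m n N

theorem zetaSum_mul_le {r t : ℝ} (hr : 0 ≤ r) (ht : 0 ≤ t) (hrt : r + t < 1) (m n : ℕ) :
    zetaSum m n * t ^ m * r ^ n ≤ (1 + (r + t)) / (1 - (r + t)) :=
  le_of_tendsto' (((tendsto_blockSum m n).mul_const _).mul_const _) fun N =>
    (blockSum_mul_le hr ht hrt true m n N).trans (ratMajorant_le (add_nonneg hr ht) hrt N)

end Limits

section GeneratingFunctions

theorem norm_mul_pow_le {𝕜 : Type*} [NormedField 𝕜] {x y : 𝕜} {r C : ℝ} {n : ℕ} (hr : 0 < r)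
    (hx : ‖x‖ * r ^ n ≤ C) : ‖x * y ^ n‖ ≤ C * (‖y‖ / r) ^ n := by
  calc ‖x * y ^ n‖ = ‖x‖ * r ^ n * (‖y‖ / r) ^ n := by
        rw [norm_mul, norm_pow, mul_assoc, ← mul_pow, mul_div_cancel₀ _ hr.ne']
    _ ≤ C * (‖y‖ / r) ^ n := by gcongr

theorem hasSum_mul_norm_div_pow {E : Type*} [SeminormedAddGroup E] {y : E} {r : ℝ} (hy : ‖y‖ < r)
    (C : ℝ) : HasSum (fun n : ℕ => C * (‖y‖ / r) ^ n) (C * (1 - ‖y‖ / r)⁻¹) :=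
  have hr := (norm_nonneg y).trans_lt hy
  (hasSum_geometric_of_lt_one (by positivity) ((div_lt_one hr).mpr hy)).mul_left C

theorem exists_gt_gt_add_lt_one {x y : ℝ} (h : x + y < 1) :
    ∃ r t : ℝ, x < r ∧ y < t ∧ r + t < 1 :=
  ⟨x + (1 - x - y) / 3, y + (1 - x - y) / 3, by linarith, by linarith, by linarith⟩

/-- The generating function of `n ↦ blockSum b m n N`. -/
noncomputable def blockGen (b : Bool) (Z : ℂ) (m N : ℕ) : ℂ := ∑' n, (blockSum b m n N : ℂ) * Z ^ n

/-- The generating function of `n ↦ zetaSum m n`. -/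
noncomputable def zetaGen (Z : ℂ) (m : ℕ) : ℂ := ∑' n, (zetaSum m n : ℂ) * Z ^ n

variable {Z W : ℂ} {r t : ℝ}

theorem norm_blockSum_mul_pow_le (hr : 0 < r) (ht : 0 < t) (hrt : r + t < 1) (b : Bool)
    (m n N : ℕ) : ‖(blockSum b m n N : ℂ) * Z ^ n‖ ≤
      blockMajorant (r + t) b m N / t ^ m * (‖Z‖ / r) ^ n := by
  refine norm_mul_pow_le hr ?_
  rw [Complex.norm_of_nonneg (blockSum_nonneg b m n N), le_div_iff₀ (pow_pos ht m), mul_right_comm]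
  exact blockSum_mul_le hr.le ht.le hrt b m n N

theorem summable_blockSum_mul_pow (hZ : ‖Z‖ < 1) (b : Bool) (m N : ℕ) :
    Summable fun n => (blockSum b m n N : ℂ) * Z ^ n := by
  obtain ⟨r, t, hr, ht, hrt⟩ := exists_gt_gt_add_lt_one (show ‖Z‖ + 0 < 1 by simpa using hZ)
  exact (hasSum_mul_norm_div_pow hr _).summable.of_norm_bounded fun n =>
    norm_blockSum_mul_pow_le ((norm_nonneg Z).trans_lt hr) ht hrt b m n N

theorem summable_zetaSum_mul_pow (hZ : ‖Z‖ < 1) (m : ℕ) :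
    Summable fun n => (zetaSum m n : ℂ) * Z ^ n := by
  obtain ⟨r, t, hr, ht, hrt⟩ := exists_gt_gt_add_lt_one (show ‖Z‖ + 0 < 1 by simpa using hZ)
  have hr0 := (norm_nonneg Z).trans_lt hr
  refine (hasSum_mul_norm_div_pow hr
    ((1 + (r + t)) / (1 - (r + t)) / t ^ m)).summable.of_norm_bounded fun n =>
      norm_mul_pow_le hr0 ?_
  rw [Complex.norm_of_nonneg (zetaSum_nonneg m n), le_div_iff₀ (pow_pos ht m), mul_right_comm]
  exact zetaSum_mul_le hr0.le ht.le hrt m n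

theorem norm_blockGen_mul_pow_le (hZ : ‖Z‖ < r) (ht : 0 < t) (hrt : r + t < 1) {b : Bool}
    {m N : ℕ} {C : ℝ} (hC : blockMajorant (r + t) b m N ≤ C) :
    ‖blockGen b Z m N * W ^ m‖ ≤ C * (1 - ‖Z‖ / r)⁻¹ * (‖W‖ / t) ^ m := by
  have hr := (norm_nonneg Z).trans_lt hZ
  have hgeom : 0 ≤ (1 - ‖Z‖ / r)⁻¹ := inv_nonneg.mpr (sub_nonneg.mpr ((div_le_one hr).mpr hZ.le))
  refine norm_mul_pow_le ht (le_trans ?_ (mul_le_mul_of_nonneg_right hC hgeom))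
  rw [← le_div_iff₀ (pow_pos ht m), mul_div_right_comm]
  exact tsum_of_norm_bounded (hasSum_mul_norm_div_pow hZ _)
    (norm_blockSum_mul_pow_le hr ht hrt b m · N)

theorem summable_blockGen_mul_pow (h : ‖Z‖ + ‖W‖ < 1) (b : Bool) (N : ℕ) :
    Summable fun m => blockGen b Z m N * W ^ m := by
  obtain ⟨r, t, hr, ht, hrt⟩ := exists_gt_gt_add_lt_one h
  have ht0 := (norm_nonneg W).trans_lt ht
  have h0 := add_nonneg ((norm_nonneg Z).trans hr.le) ht0.le
  exact (hasSum_mul_norm_div_pow ht _).summable.of_norm_bounded fun m =>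
    norm_blockGen_mul_pow_le hr ht0 hrt (blockMajorant_le h0 hrt b m N)

theorem tendsto_blockGen (hZ : ‖Z‖ < 1) (m : ℕ) :
    Tendsto (blockGen true Z m) atTop (𝓝 (zetaGen Z m)) := by
  obtain ⟨r, t, hr, ht, hrt⟩ := exists_gt_gt_add_lt_one (show ‖Z‖ + 0 < 1 by simpa using hZ)
  have hr0 := (norm_nonneg Z).trans_lt hr
  refine tendsto_tsum_of_dominated_convergence
    (hasSum_mul_norm_div_pow hr ((1 + (r + t)) / (1 - (r + t)) / t ^ m)).summable (fun n => ?_)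
    (.of_forall fun N n => (norm_blockSum_mul_pow_le hr0 ht hrt true m n N).trans ?_)
  · exact ((Complex.continuous_ofReal.tendsto _).comp (tendsto_blockSum m n)).mul_const _
  · gcongr
    exact ratMajorant_le (by positivity) hrt N

theorem exists_summable_norm_blockGen_le (h : ‖Z‖ + ‖W‖ < 1) :
    ∃ u : ℕ → ℝ, Summable u ∧ ∀ N m, ‖blockGen true Z m N * W ^ m‖ ≤ u m := by
  obtain ⟨r, t, hr, ht, hrt⟩ := exists_gt_gt_add_lt_one h
  have ht0 := (norm_nonneg W).trans_lt ht
  have h0 := add_nonneg ((norm_nonneg Z).trans hr.le) ht0.le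
  exact ⟨_, (hasSum_mul_norm_div_pow ht _).summable, fun N m =>
    norm_blockGen_mul_pow_le hr ht0 hrt (ratMajorant_le h0 hrt N)⟩

theorem summable_zetaGen_mul_pow (h : ‖Z‖ + ‖W‖ < 1) : Summable fun m => zetaGen Z m * W ^ m := by
  obtain ⟨u, hu, hle⟩ := exists_summable_norm_blockGen_le h
  have hZ : ‖Z‖ < 1 := by linarith [norm_nonneg W]
  exact hu.of_norm_bounded fun m =>
    le_of_tendsto' ((tendsto_blockGen hZ m).mul_const _).norm fun N => hle N m

theorem tendsto_tsum_blockGen (h : ‖Z‖ + ‖W‖ < 1) :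
    Tendsto (fun N => ∑' m, blockGen true Z m N * W ^ m) atTop (𝓝 (∑' m, zetaGen Z m * W ^ m)) := by
  obtain ⟨u, hu, hle⟩ := exists_summable_norm_blockGen_le h
  have hZ : ‖Z‖ < 1 := by linarith [norm_nonneg W]
  exact tendsto_tsum_of_dominated_convergence hu (fun m => (tendsto_blockGen hZ m).mul_const _)
    (.of_forall hle)

end GeneratingFunctions

section Recursions

theorem tsum_mul_pow_of_succ {𝕜 : Type*} [NormedField 𝕜] {f g h : ℕ → 𝕜} {x : 𝕜}
    (h0 : f 0 = g 0) (hsucc : ∀ n, f (n + 1) = g (n + 1) + h n)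
    (hf : Summable fun n => f n * x ^ n) (hg : Summable fun n => g n * x ^ n)
    (hh : Summable fun n => h n * x ^ n) :
    ∑' n, f n * x ^ n = ∑' n, g n * x ^ n + x * ∑' n, h n * x ^ n := by
  have key : ∀ n, f (n + 1) * x ^ (n + 1) = g (n + 1) * x ^ (n + 1) + x * (h n * x ^ n) :=
    fun n => by rw [hsucc]; ring
  rw [hf.tsum_eq_zero_add, hg.tsum_eq_zero_add, h0, add_assoc, tsum_congr key,
    ((summable_nat_add_iff 1).mpr hg).tsum_add (hh.mul_left x), tsum_mul_left]

variable {Z W : ℂ}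

theorem blockGen_zero_left (b : Bool) (Z : ℂ) (N : ℕ) : blockGen b Z 0 N = 1 := by
  rw [blockGen, tsum_eq_single 0]
  · simp [blockSum_zero_zero]
  · intro n hn
    obtain ⟨n, rfl⟩ := Nat.exists_eq_succ_of_ne_zero hn
    simp [blockSum_zero_succ]

theorem blockGen_succ_trunc_zero (b : Bool) (Z : ℂ) (m : ℕ) : blockGen b Z (m + 1) 0 = 0 := by
  simp [blockGen, blockSum_succ_trunc_zero]

theorem blockGen_succ_trunc_succ (hZ : ‖Z‖ < 1) (b : Bool) (m N : ℕ) :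
    blockGen b Z (m + 1) (N + 1) = blockGen b Z (m + 1) N +
      blockGen (!b) Z m (N + 1) / ((N : ℂ) + 1) ^ closingLetter b m +
      Z / ((N : ℂ) + 1) ^ 2 * blockGen b Z (m + 1) (N + 1) := by
  set k : ℂ := (N : ℂ) + 1
  have hdiv : ∀ (b : Bool) (m s : ℕ), HasSum (fun n => (blockSum b m n (N + 1) : ℂ) / k ^ s * Z ^ n)
      (blockGen b Z m (N + 1) / k ^ s) := fun b m s =>
    ((summable_blockSum_mul_pow hZ b m (N + 1)).hasSum.div_const _).congr_fun
      fun n => div_mul_eq_mul_div _ _ _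
  have hg : HasSum (fun n => ((blockSum b (m + 1) n N : ℂ) +
      blockSum (!b) m n (N + 1) / k ^ closingLetter b m) * Z ^ n)
      (blockGen b Z (m + 1) N + blockGen (!b) Z m (N + 1) / k ^ closingLetter b m) :=
    ((summable_blockSum_mul_pow hZ b (m + 1) N).hasSum.add (hdiv _ _ _)).congr_fun
      fun n => add_mul _ _ _
  have hsucc : ∀ n, (blockSum b (m + 1) (n + 1) (N + 1) : ℂ) = (blockSum b (m + 1) (n + 1) N +
      blockSum (!b) m (n + 1) (N + 1) / k ^ closingLetter b m) +
      blockSum b (m + 1) n (N + 1) / k ^ 2 := fun n => by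
    rw [blockSum_succ_succ_trunc_succ]; push_cast; ring
  have key := tsum_mul_pow_of_succ (by simp [blockSum_succ_zero_trunc_succ, k]) hsucc
    (summable_blockSum_mul_pow hZ b (m + 1) (N + 1)) hg.summable (hdiv b (m + 1) 2).summable
  rw [hg.tsum_eq, (hdiv b (m + 1) 2).tsum_eq] at key
  exact key.trans (by rw [div_mul_eq_mul_div, mul_div_assoc])

/-- The generating function of `m ↦ blockGen b Z m N`. -/
noncomputable def wordGen (b : Bool) (Z W : ℂ) (N : ℕ) : ℂ := ∑' m, blockGen b Z m N * W ^ m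

theorem wordGen_trunc_zero (b : Bool) (Z W : ℂ) : wordGen b Z W 0 = 1 := by
  rw [wordGen, tsum_eq_single 0]
  · simp [blockGen_zero_left]
  · intro m hm
    obtain ⟨m, rfl⟩ := Nat.exists_eq_succ_of_ne_zero hm
    simp [blockGen_succ_trunc_zero]

theorem hasSum_blockGen_succ (h : ‖Z‖ + ‖W‖ < 1) (b : Bool) (N : ℕ) :
    HasSum (fun m => blockGen b Z (m + 1) N * W ^ (m + 1)) (wordGen b Z W N - 1) := by
  simpa [blockGen_zero_left, wordGen] using
    (hasSum_nat_add_iff' 1).mpr (summable_blockGen_mul_pow h b N).hasSum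

theorem hasSum_blockGen_div_closingLetter (h : ‖Z‖ + ‖W‖ < 1) (b : Bool) (N : ℕ) :
    HasSum (fun m => blockGen (!b) Z m (N + 1) / ((N : ℂ) + 1) ^ closingLetter b m * W ^ (m + 1))
      (wordGen b Z W (N + 1) - wordGen b Z W N -
        Z / ((N : ℂ) + 1) ^ 2 * (wordGen b Z W (N + 1) - 1)) := by
  have hZ : ‖Z‖ < 1 := by linarith [norm_nonneg W]
  rw [← sub_sub_sub_cancel_right (wordGen b Z W (N + 1)) _ 1]
  refine (((hasSum_blockGen_succ h b (N + 1)).sub (hasSum_blockGen_succ h b N)).sub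
    ((hasSum_blockGen_succ h b (N + 1)).mul_left (Z / ((N : ℂ) + 1) ^ 2))).congr_fun fun m => ?_
  linear_combination -W ^ (m + 1) * blockGen_succ_trunc_succ hZ b m N

theorem wordGen_true_trunc_succ (h : ‖Z‖ + ‖W‖ < 1) (N : ℕ) :
    ((N : ℂ) + 1) ^ 2 * (wordGen true Z W (N + 1) - wordGen true Z W N) =
      Z * (wordGen true Z W (N + 1) - 1) +
        W * ((wordGen false Z W (N + 1) - 1) / ((N : ℂ) + 1) + 1) := by
  have hN : (N : ℂ) + 1 ≠ 0 := Nat.cast_add_one_ne_zero N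
  have htail : HasSum (fun m => blockGen false Z (m + 1) (N + 1) /
      ((N : ℂ) + 1) ^ closingLetter true (m + 1) * W ^ (m + 1 + 1))
      ((wordGen false Z W (N + 1) - 1) * (W / ((N : ℂ) + 1) ^ 3)) := by
    refine ((hasSum_blockGen_succ h false (N + 1)).mul_right _).congr_fun fun m => ?_
    simp only [closingLetter, if_true, Nat.succ_ne_zero, if_false]
    ring
  have := (hasSum_blockGen_div_closingLetter h true N).unique ((hasSum_nat_add_iff 1).mp htail)
  simp only [Finset.sum_range_one, blockGen_zero_left, closingLetter, if_true] at this
  field_simp at this ⊢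
  linear_combination this

theorem wordGen_false_trunc_succ (h : ‖Z‖ + ‖W‖ < 1) (N : ℕ) :
    ((N : ℂ) + 1) ^ 2 * (wordGen false Z W (N + 1) - wordGen false Z W N) =
      Z * (wordGen false Z W (N + 1) - 1) + W * (((N : ℂ) + 1) * wordGen true Z W (N + 1)) := by
  have hN : (N : ℂ) + 1 ≠ 0 := Nat.cast_add_one_ne_zero N
  have hsum : HasSum (fun m => blockGen true Z m (N + 1) /
      ((N : ℂ) + 1) ^ closingLetter false m * W ^ (m + 1))
      (wordGen true Z W (N + 1) * (W / ((N : ℂ) + 1))) := by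
    refine ((summable_blockGen_mul_pow h true (N + 1)).hasSum.mul_right _).congr_fun fun m => ?_
    simp only [closingLetter, Bool.false_eq_true, if_false]
    ring
  have := (hasSum_blockGen_div_closingLetter h false N).unique hsum
  field_simp at this ⊢
  linear_combination this

end Recursions

section Connectors

variable {K : Type*} [Field K]

/-- The connector `n!² / ((n - k)! (n + k)!)`, which vanishes for `k > n`. -/
def connector (K : Type*) [Field K] (n k : ℕ) : K := (n.choose k : K) / ((n + k).choose k : K)

theorem connector_zero_right (n : ℕ) : connector K n 0 = 1 := by simp [connector]

theorem connector_eq_zero_of_lt {n k : ℕ} (h : n < k) : connector K n k = 0 := by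
  simp [connector, Nat.choose_eq_zero_of_lt h]

theorem connector_succ_right [CharZero K] (n k : ℕ) :
    (n + k + 1) * connector K n (k + 1) = ((n : K) - k) * connector K n k := by
  rcases lt_or_ge n k with h | h
  · simp [connector_eq_zero_of_lt h, connector_eq_zero_of_lt (h.trans k.lt_succ_self)]
  have num_succ : (n.choose (k + 1) : K) * (k + 1) = n.choose k * ((n : K) - k) := by
    rw [← Nat.cast_sub h]
    exact_mod_cast Nat.choose_succ_right_eq n k
  have den_succ : ((n + k + 1).choose (k + 1) : K) * (k + 1) = (n + k + 1) * (n + k).choose k := by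
    exact_mod_cast (Nat.add_one_mul_choose_eq (n + k) k).symm
  have den_ne : ((n + k).choose k : K) ≠ 0 :=
    Nat.cast_ne_zero.mpr (Nat.choose_pos (Nat.le_add_left k n)).ne'
  have den_succ_ne : ((n + k + 1).choose (k + 1) : K) ≠ 0 :=
    Nat.cast_ne_zero.mpr (Nat.choose_pos (by omega)).ne'
  rw [connector, connector, ← add_assoc n k 1, mul_div_assoc', mul_div_assoc',
    div_eq_div_iff den_succ_ne den_ne]
  refine mul_right_cancel₀ (Nat.cast_add_one_ne_zero k) ?_
  linear_combination (n + k + 1) * ((n + k).choose k : K) * num_succ -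
    ((n : K) - k) * n.choose k * den_succ

theorem connector_succ_left [CharZero K] (n k : ℕ) :
    ((n : K) + 1) ^ 2 * (connector K (n + 1) k - connector K n k) =
      (k : K) ^ 2 * connector K (n + 1) k := by
  have num_succ : ((n + 1).choose k : K) * ((n : K) + 1 - k) = n.choose k * (n + 1) := by
    rcases le_or_gt k (n + 1) with h | h
    · have := Nat.choose_mul_succ_eq n k
      rw [show (n : K) + 1 - k = (n + 1 - k : ℕ) by push_cast [h]; ring]
      exact_mod_cast this.symm
    · simp [Nat.choose_eq_zero_of_lt h, Nat.choose_eq_zero_of_lt (show n < k by omega)]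
  have den_succ : ((n + k + 1).choose k : K) * (n + 1) = (n + k).choose k * (n + k + 1) := by
    have := Nat.choose_mul_succ_eq (n + k) k
    rw [show n + k + 1 - k = n + 1 by omega] at this
    exact_mod_cast this.symm
  have den_ne : ((n + k).choose k : K) ≠ 0 :=
    Nat.cast_ne_zero.mpr (Nat.choose_pos (Nat.le_add_left k n)).ne'
  have den_succ_ne : ((n + k + 1).choose k : K) ≠ 0 :=
    Nat.cast_ne_zero.mpr (Nat.choose_pos (by omega)).ne'
  rw [connector, connector, show n + 1 + k = n + k + 1 by omega]
  field_simp
  linear_combination ((n : K) + 1) * ((n + k + 1).choose k : K) * num_succ -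
    ((n + 1).choose k : K) * ((n : K) + 1 - k) * den_succ

/-- The partial sums `r 0 + ∑_{k=1}^n (r k - r (k - 1))` of a sequence, weighted by connectors. -/
def connectorSum (r : ℕ → K) (n : ℕ) : K :=
  r 0 + ∑ k ∈ range n, (r (k + 1) - r k) * connector K n (k + 1)

theorem connectorSum_zero (r : ℕ → K) : connectorSum r 0 = r 0 := by
  rw [connectorSum, range_zero, sum_empty, add_zero]

variable [CharZero K]

theorem sq_mul_sum_connector_sub (c : ℕ → K) (n : ℕ) :
    ((n : K) + 1) ^ 2 * (∑ k ∈ range (n + 1), c k * connector K (n + 1) (k + 1) -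
        ∑ k ∈ range n, c k * connector K n (k + 1)) =
      ∑ k ∈ range (n + 1), ((k : K) + 1) ^ 2 * c k * connector K (n + 1) (k + 1) := by
  have extend : ∑ k ∈ range n, c k * connector K n (k + 1) =
      ∑ k ∈ range (n + 1), c k * connector K n (k + 1) := by
    rw [sum_range_succ, connector_eq_zero_of_lt n.lt_succ_self, mul_zero, add_zero]
  rw [extend, ← sum_sub_distrib, mul_sum]
  refine sum_congr rfl fun k _ => ?_
  have := connector_succ_left (K := K) n (k + 1)
  push_cast at this
  linear_combination c k * this

theorem natCast_mul_connectorSum (r : ℕ → K) (n : ℕ) :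
    (n : K) * connectorSum r n =
      ∑ k ∈ range n, ((k : K) + 1) * (r (k + 1) + r k) * connector K n (k + 1) := by
  have partial_sum : ∀ m : ℕ,
      (n : K) * (r 0 + ∑ k ∈ range m, (r (k + 1) - r k) * connector K n (k + 1)) =
        ∑ k ∈ range m, ((k : K) + 1) * (r (k + 1) + r k) * connector K n (k + 1) +
          (n - m) * r m * connector K n m := by
    intro m
    induction m with
    | zero => simp [connector_zero_right]
    | succ m ih =>
      rw [sum_range_succ, sum_range_succ, ← add_assoc, mul_add, ih]
      push_cast
      linear_combination -r m * connector_succ_right (K := K) n m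
  rw [connectorSum, partial_sum n, sub_self, zero_mul, zero_mul, add_zero]

variable {Z W : K} {r q : ℕ → K}

theorem sq_mul_connectorSum_sub
    (hr : ∀ k : ℕ, (((k : K) + 1) ^ 2 - Z) * (r (k + 1) - r k) = W * (q (k + 1) - q k)) (n : ℕ) :
    ((n : K) + 1) ^ 2 * (connectorSum r (n + 1) - connectorSum r n) =
      Z * (connectorSum r (n + 1) - r 0) + W * (connectorSum q (n + 1) - q 0) := by
  simp only [connectorSum, add_sub_add_left_eq_sub, add_sub_cancel_left, sq_mul_sum_connector_sub,
    mul_sum, ← sum_add_distrib]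
  refine sum_congr rfl fun k _ => ?_
  linear_combination connector K (n + 1) (k + 1) * hr k

theorem sq_mul_natCast_mul_connectorSum_sub
    (hq : ∀ k : ℕ, (((k : K) + 1) ^ 2 - Z) * (q (k + 1) + q k) = W * (r (k + 1) + r k)) (n : ℕ) :
    ((n : K) + 1) ^ 2 * (((n + 1 : ℕ) : K) * connectorSum q (n + 1) - n * connectorSum q n) =
      Z * (((n + 1 : ℕ) : K) * connectorSum q (n + 1)) +
        W * (((n + 1 : ℕ) : K) * connectorSum r (n + 1)) := by
  simp only [natCast_mul_connectorSum, sq_mul_sum_connector_sub, mul_sum, ← sum_add_distrib]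
  refine sum_congr rfl fun k _ => ?_
  linear_combination ((k : K) + 1) * connector K (n + 1) (k + 1) * hq k

theorem eq_connectorSum_of_recurrence {E F : ℕ → K}
    (hr : ∀ k : ℕ, (((k : K) + 1) ^ 2 - Z) * (r (k + 1) - r k) = W * (q (k + 1) - q k))
    (hq : ∀ k : ℕ, (((k : K) + 1) ^ 2 - Z) * (q (k + 1) + q k) = W * (r (k + 1) + r k))
    (hne : ∀ k : ℕ, (((k : K) + 1) ^ 2 - Z) ^ 2 ≠ W ^ 2) (hE0 : E 0 = r 0) (hF0 : F 0 = 0)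
    (hE : ∀ n : ℕ, ((n : K) + 1) ^ 2 * (E (n + 1) - E n) =
      Z * (E (n + 1) - r 0) + W * (F (n + 1) / (n + 1) - q 0))
    (hF : ∀ n : ℕ, ((n : K) + 1) ^ 2 * (F (n + 1) - F n) =
      Z * F (n + 1) + W * ((n + 1) * E (n + 1))) (n : ℕ) :
    E n = connectorSum r n ∧ F n = n * connectorSum q n := by
  induction n with
  | zero => simp [hE0, hF0, connectorSum_zero]
  | succ n ih =>
    have hn : (n : K) + 1 ≠ 0 := Nat.cast_add_one_ne_zero n
    set u := E (n + 1) - connectorSum r (n + 1)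
    set v := F (n + 1) / (n + 1) - connectorSum q (n + 1)
    have hF' : F (n + 1) = (n + 1) * (F (n + 1) / (n + 1)) := (mul_div_cancel₀ _ hn).symm
    have hrec := sq_mul_natCast_mul_connectorSum_sub hq n
    push_cast at hrec
    have hu : (((n : K) + 1) ^ 2 - Z) * u = W * v := by
      linear_combination hE n - sq_mul_connectorSum_sub hr n + ((n : K) + 1) ^ 2 * ih.1
    have hv : (((n : K) + 1) ^ 2 - Z) * v = W * u := by
      refine mul_left_cancel₀ hn ?_
      linear_combination hF n - hrec + ((n : K) + 1) ^ 2 * ih.2 - (((n : K) + 1) ^ 2 - Z) * hF'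
    have hdet := sub_ne_zero.mpr (hne n)
    have hu0 : u = 0 := (mul_eq_zero.mp (show (_ : K) * u = 0 by
      linear_combination (((n : K) + 1) ^ 2 - Z) * hu + W * hv)).resolve_left hdet
    have hv0 : v = 0 := (mul_eq_zero.mp (show (_ : K) * v = 0 by
      linear_combination (((n : K) + 1) ^ 2 - Z) * hv + W * hu)).resolve_left hdet
    refine ⟨sub_eq_zero.mp hu0, ?_⟩
    push_cast
    linear_combination hF' + (n + 1) * hv0

end Connectors

section AlternatingProduct

variable {K : Type*} [Field K]

/-- The partial products of `∏_{k ≥ 1} (k² - Z - (-1)^k W) / (k² - Z + (-1)^k W)`. -/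
def altProd (Z W : K) (n : ℕ) : K :=
  ∏ k ∈ range n, (((k : K) + 1) ^ 2 - Z + (-1) ^ k * W) / (((k : K) + 1) ^ 2 - Z - (-1) ^ k * W)

theorem altProd_zero (Z W : K) : altProd Z W 0 = 1 := prod_range_zero _

variable {Z W : K} {k : ℕ}

theorem altProd_succ_mul (h : ((k : K) + 1) ^ 2 - Z - (-1) ^ k * W ≠ 0) :
    altProd Z W (k + 1) * (((k : K) + 1) ^ 2 - Z - (-1) ^ k * W) =
      altProd Z W k * (((k : K) + 1) ^ 2 - Z + (-1) ^ k * W) := by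
  rw [altProd, prod_range_succ, ← altProd, mul_assoc, div_mul_cancel₀ _ h]

theorem mul_altProd_sub (h : ((k : K) + 1) ^ 2 - Z - (-1) ^ k * W ≠ 0) :
    (((k : K) + 1) ^ 2 - Z) * (altProd Z W (k + 1) - altProd Z W k) =
      W * ((-1) ^ (k + 2) * altProd Z W (k + 1) - (-1) ^ (k + 1) * altProd Z W k) := by
  rw [pow_succ, pow_succ]
  linear_combination altProd_succ_mul h

theorem mul_altProd_add (h : ((k : K) + 1) ^ 2 - Z - (-1) ^ k * W ≠ 0) :
    (((k : K) + 1) ^ 2 - Z) *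
        ((-1) ^ (k + 2) * altProd Z W (k + 1) + (-1) ^ (k + 1) * altProd Z W k) =
      W * (altProd Z W (k + 1) + altProd Z W k) := by
  have hsq : ((-1 : K) ^ k) * (-1) ^ k = 1 := by rw [← mul_pow]; simp
  rw [pow_succ, pow_succ]
  linear_combination (-1) ^ k * altProd_succ_mul h +
    W * (altProd Z W (k + 1) + altProd Z W k) * hsq

end AlternatingProduct

section Convergence

variable {𝕜 : Type*} [RCLike 𝕜]

theorem norm_connector_le_one (n k : ℕ) : ‖connector 𝕜 n k‖ ≤ 1 := by
  rw [connector, norm_div, RCLike.norm_natCast, RCLike.norm_natCast]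
  exact div_le_one_of_le₀ (Nat.cast_le.mpr (Nat.choose_mono k (Nat.le_add_right n k)))
    (Nat.cast_nonneg _)

theorem tendsto_connector (k : ℕ) : Tendsto (connector 𝕜 · k) atTop (𝓝 1) := by
  induction k with
  | zero => simp [connector_zero_right]
  | succ k ih =>
    have ratio : Tendsto (fun n : ℕ => ((n : 𝕜) - k) / (n + k + 1)) atTop (𝓝 1) := by
      have := (tendsto_const_div_atTop_nhds_zero_nat (2 * k + 1 : 𝕜)).comp
        (tendsto_add_atTop_nat (k + 1))
      refine (sub_zero (1 : 𝕜) ▸ this.const_sub 1).congr fun n => ?_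
      have : (n : 𝕜) + k + 1 ≠ 0 := by exact_mod_cast (n + k).succ_ne_zero
      rw [Function.comp_apply, eq_div_iff this]
      push_cast
      rw [← add_assoc, sub_mul, div_mul_cancel₀ _ this]
      ring
    refine (mul_one (1 : 𝕜) ▸ ratio.mul ih).congr fun n => ?_
    have : (n : 𝕜) + k + 1 ≠ 0 := by exact_mod_cast (n + k).succ_ne_zero
    rw [div_mul_eq_mul_div, ← connector_succ_right, mul_div_cancel_left₀ _ this]

theorem tendsto_connectorSum {r : ℕ → 𝕜} (hr : Summable fun k => ‖r (k + 1) - r k‖) :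
    Tendsto (connectorSum r) atTop (𝓝 (r 0 + ∑' k, (r (k + 1) - r k))) := by
  have as_tsum : ∀ n, ∑' k, (r (k + 1) - r k) * connector 𝕜 n (k + 1) =
      ∑ k ∈ range n, (r (k + 1) - r k) * connector 𝕜 n (k + 1) := fun n =>
    tsum_eq_sum fun k hk => by
      rw [connector_eq_zero_of_lt (by simpa [Nat.lt_succ_iff] using hk), mul_zero]
  refine (Tendsto.congr as_tsum ?_).const_add (r 0)
  refine tendsto_tsum_of_dominated_convergence hr (fun k => ?_) (.of_forall fun n k => ?_)
  · simpa using (tendsto_connector (𝕜 := 𝕜) (k + 1)).const_mul (r (k + 1) - r k)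
  · rw [norm_mul]
    exact mul_le_of_le_one_right (norm_nonneg _) (norm_connector_le_one _ _)

theorem norm_prod_range_succ_sub_le {f : ℕ → 𝕜} {v : ℕ → ℝ} (hv : Summable v)
    (hf : ∀ i, ‖f i‖ ≤ v i) (n : ℕ) :
    ‖∏ i ∈ range (n + 1), (1 + f i) - ∏ i ∈ range n, (1 + f i)‖ ≤ Real.exp (∑' i, v i) * v n := by
  have norm_prod_le : ‖∏ i ∈ range n, (1 + f i)‖ ≤ Real.exp (∑' i, v i) := by
    calc _ ≤ ∏ i ∈ range n, (1 + v i) := by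
          rw [norm_prod]
          refine prod_le_prod (fun _ _ => norm_nonneg _) fun i _ => (norm_add_le _ _).trans ?_
          rw [norm_one]
          exact add_le_add_right (hf i) 1
      _ ≤ Real.exp (∑ i ∈ range n, v i) :=
          Real.prod_one_add_le_exp_sum _ fun i => (norm_nonneg _).trans (hf i)
      _ ≤ _ := Real.exp_le_exp.mpr (hv.sum_le_tsum _ fun i _ => (norm_nonneg _).trans (hf i))
  rw [prod_range_succ, mul_add, mul_one, add_sub_cancel_left, norm_mul]
  exact mul_le_mul norm_prod_le (hf n) (norm_nonneg _) (Real.exp_pos _).le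

variable {Z W : 𝕜} {R : ℝ}

theorem exists_mul_sq_add_le_norm_sq_sub (hZ : ‖Z‖ < 1) (hR : R < ‖1 - Z‖) :
    ∃ δ : ℝ, 0 < δ ∧ ∀ k : ℕ, δ * ((k : ℝ) + 1) ^ 2 + R ≤ ‖((k : 𝕜) + 1) ^ 2 - Z‖ := by
  refine ⟨min (‖1 - Z‖ - R) (1 / 4), lt_min (sub_pos.mpr hR) (by norm_num), fun k => ?_⟩
  rcases Nat.eq_zero_or_pos k with rfl | hk
  · simpa [add_comm] using le_sub_iff_add_le.mp (min_le_left (‖1 - Z‖ - R) (1 / 4))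
  · have hsq : ‖((k : 𝕜) + 1) ^ 2‖ = ((k : ℝ) + 1) ^ 2 := by
      rw [norm_pow, ← Nat.cast_succ, RCLike.norm_natCast, Nat.cast_succ]
    have hle := hsq ▸ norm_sub_norm_le (((k : 𝕜) + 1) ^ 2) Z
    have hsub : ‖1 - Z‖ ≤ 1 + ‖Z‖ := by simpa using norm_sub_le 1 Z
    have hmin : min (‖1 - Z‖ - R) (1 / 4) * ((k : ℝ) + 1) ^ 2 ≤ 1 / 4 * ((k : ℝ) + 1) ^ 2 := by
      gcongr
      exact min_le_right _ _
    have hk1 : (1 : ℝ) ≤ k := by exact_mod_cast hk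
    nlinarith

theorem norm_lt_norm_sq_sub (hZ : ‖Z‖ < 1) (hW : ‖W‖ < ‖1 - Z‖) (k : ℕ) :
    ‖W‖ < ‖((k : 𝕜) + 1) ^ 2 - Z‖ := by
  obtain ⟨δ, hδ, h⟩ := exists_mul_sq_add_le_norm_sq_sub hZ hW
  exact (lt_add_of_pos_left _ (by positivity)).trans_le (h k)

theorem sq_sub_sub_ne_zero (hZ : ‖Z‖ < 1) (hW : ‖W‖ < ‖1 - Z‖) (k : ℕ) :
    ((k : 𝕜) + 1) ^ 2 - Z - (-1) ^ k * W ≠ 0 := fun h =>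
  (norm_lt_norm_sq_sub hZ hW k).ne' (by simpa using congrArg norm (sub_eq_zero.mp h))

theorem exists_summable_norm_altProd_sub_le (hZ : ‖Z‖ < 1) (hR : R < ‖1 - Z‖) :
    ∃ u : ℕ → ℝ, Summable u ∧ ∀ (k : ℕ) (W : 𝕜), ‖W‖ ≤ R →
      ‖altProd Z W (k + 1) - altProd Z W k‖ ≤ u k := by
  obtain ⟨δ, hδ, hle⟩ := exists_mul_sq_add_le_norm_sq_sub hZ hR
  set v : ℕ → ℝ := fun k => 2 * |R| / δ * (1 / ((k : ℝ) + 1) ^ 2)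
  have hv : Summable v := by
    have := (summable_nat_add_iff 1).mpr (Real.summable_one_div_nat_pow.mpr one_lt_two)
    exact Summable.mul_left _ (by simpa using this)
  refine ⟨fun k => Real.exp (∑' i, v i) * v k, hv.mul_left _, fun k W hW => ?_⟩
  set f : ℕ → 𝕜 := fun k => 2 * ((-1) ^ k * W) / (((k : 𝕜) + 1) ^ 2 - Z - (-1) ^ k * W)
  have hf : ∀ k, ‖f k‖ ≤ v k := fun k => by
    have hden : δ * ((k : ℝ) + 1) ^ 2 ≤ ‖((k : 𝕜) + 1) ^ 2 - Z - (-1) ^ k * W‖ := by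
      have : ‖((k : 𝕜) + 1) ^ 2 - Z‖ - ‖W‖ ≤ ‖((k : 𝕜) + 1) ^ 2 - Z - (-1) ^ k * W‖ := by
        simpa using norm_sub_norm_le (((k : 𝕜) + 1) ^ 2 - Z) ((-1) ^ k * W)
      linarith [hle k]
    have hnum : ‖2 * ((-1) ^ k * W)‖ ≤ 2 * |R| := by simpa using hW.trans (le_abs_self R)
    calc ‖f k‖ ≤ 2 * |R| / (δ * ((k : ℝ) + 1) ^ 2) := by
          rw [norm_div]
          exact div_le_div₀ (by positivity) hnum (by positivity) hden
      _ = v k := by simp only [v, div_mul_div_comm, mul_one]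
  have altProd_eq : ∀ n, altProd Z W n = ∏ i ∈ range n, (1 + f i) := fun n =>
    prod_congr rfl fun i _ => by
      rw [one_add_div (sq_sub_sub_ne_zero hZ (hW.trans_lt hR) i)]
      congr 1
      ring
  rw [altProd_eq, altProd_eq]
  exact norm_prod_range_succ_sub_le hv hf k

/-- The infinite product `∏_{k ≥ 1} (k² - Z - (-1)^k W) / (k² - Z + (-1)^k W)`, encoded as the
telescoping series over its partial products. -/
noncomputable def altProdLim (Z W : 𝕜) : 𝕜 := 1 + ∑' k, (altProd Z W (k + 1) - altProd Z W k)

theorem summable_norm_altProd_sub (hZ : ‖Z‖ < 1) (hW : ‖W‖ < ‖1 - Z‖) :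
    Summable fun k => ‖altProd Z W (k + 1) - altProd Z W k‖ := by
  obtain ⟨u, hu, h⟩ := exists_summable_norm_altProd_sub_le hZ hW
  exact .of_nonneg_of_le (fun _ => norm_nonneg _) (fun k => h k W le_rfl) hu

theorem tendsto_altProd (hZ : ‖Z‖ < 1) (hW : ‖W‖ < ‖1 - Z‖) :
    Tendsto (altProd Z W) atTop (𝓝 (altProdLim Z W)) := by
  refine ((summable_norm_altProd_sub hZ hW).of_norm.hasSum.tendsto_sum_nat.const_add 1).congr
    fun n => ?_
  rw [sum_range_sub, altProd_zero, add_sub_cancel]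

theorem tendsto_connectorSum_altProd (hZ : ‖Z‖ < 1) (hW : ‖W‖ < ‖1 - Z‖) :
    Tendsto (connectorSum (altProd Z W)) atTop (𝓝 (altProdLim Z W)) := by
  simpa only [altProdLim, altProd_zero] using tendsto_connectorSum (summable_norm_altProd_sub hZ hW)

theorem differentiableOn_altProdLim {Z : ℂ} (hZ : ‖Z‖ < 1) :
    DifferentiableOn ℂ (altProdLim Z) (Metric.ball 0 ‖1 - Z‖) := by
  intro W hW
  obtain ⟨R, hWR, hR⟩ := exists_between (mem_ball_zero_iff.mp hW)
  obtain ⟨u, hu, hle⟩ := exists_summable_norm_altProd_sub_le hZ hR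
  have partial_products : ∀ k, DifferentiableOn ℂ (fun V => altProd Z V k) (Metric.ball 0 R) :=
    fun k => DifferentiableOn.fun_finsetProd fun i _ =>
      DifferentiableOn.div (by fun_prop) (by fun_prop) fun V hV =>
        sq_sub_sub_ne_zero hZ ((mem_ball_zero_iff.mp hV).trans hR) i
  have on_ball : DifferentiableOn ℂ (altProdLim Z) (Metric.ball 0 R) :=
    (Complex.differentiableOn_tsum_of_summable_norm hu
      (fun k => (partial_products (k + 1)).sub (partial_products k)) Metric.isOpen_ball
      fun k V hV => hle k V (mem_ball_zero_iff.mp hV).le).const_add 1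
  exact (on_ball.differentiableAt
    (Metric.isOpen_ball.mem_nhds (mem_ball_zero_iff.mpr hWR))).differentiableWithinAt

end Convergence

section PowerSeries

variable {Z W : ℂ}

theorem norm_lt_norm_one_sub (h : ‖Z‖ + ‖W‖ < 1) : ‖W‖ < ‖1 - Z‖ := by
  linarith [norm_sub_norm_le 1 Z, norm_one (α := ℂ)]

theorem wordGen_true_eq_connectorSum (h : ‖Z‖ + ‖W‖ < 1) (N : ℕ) :
    wordGen true Z W N = connectorSum (altProd Z W) N := by
  have hZ : ‖Z‖ < 1 := by linarith [norm_nonneg W]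
  have hW := norm_lt_norm_one_sub h
  refine (eq_connectorSum_of_recurrence (E := wordGen true Z W) (F := (wordGen false Z W · - 1))
    (q := fun k => (-1) ^ (k + 1) * altProd Z W k)
    (fun k => mul_altProd_sub (sq_sub_sub_ne_zero hZ hW k))
    (fun k => mul_altProd_add (sq_sub_sub_ne_zero hZ hW k)) (fun k hk => ?_)
    (by rw [wordGen_trunc_zero, altProd_zero]) (sub_eq_zero.mpr (wordGen_trunc_zero _ _ _))
    (fun n => ?_) (fun n => ?_) N).1
  · exact (norm_lt_norm_sq_sub hZ hW k).ne' <| (pow_left_inj₀ (norm_nonneg _) (norm_nonneg _)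
      two_ne_zero).mp (by rw [← norm_pow, hk, norm_pow])
  · simpa [altProd_zero] using wordGen_true_trunc_succ h n
  · simpa using wordGen_false_trunc_succ h n

theorem hasSum_zetaGen_of_add_lt_one (h : ‖Z‖ + ‖W‖ < 1) :
    HasSum (fun m => zetaGen Z m * W ^ m) (altProdLim Z W) := by
  have hZ : ‖Z‖ < 1 := by linarith [norm_nonneg W]
  have hW := norm_lt_norm_one_sub h
  refine (summable_zetaGen_mul_pow h).hasSum_iff.mpr (tendsto_nhds_unique
    (tendsto_tsum_blockGen h) ((tendsto_connectorSum_altProd hZ hW).congr fun N => ?_))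
  exact (wordGen_true_eq_connectorSum h N).symm

theorem hasSum_zetaGen (hZ : ‖Z‖ < 1) (hW : ‖W‖ < ‖1 - Z‖) :
    HasSum (fun m => zetaGen Z m * W ^ m) (altProdLim Z W) := by
  have near_zero : HasFPowerSeriesAt (altProdLim Z)
      (FormalMultilinearSeries.ofScalars ℂ (zetaGen Z)) 0 := by
    rw [hasFPowerSeriesAt_iff]
    filter_upwards [Metric.ball_mem_nhds (0 : ℂ) (sub_pos.mpr hZ)] with V hV
    rw [zero_add]
    simpa [mul_comm] using
      hasSum_zetaGen_of_add_lt_one (lt_sub_iff_add_lt'.mp (mem_ball_zero_iff.mp hV))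
  obtain ⟨R, hWR, hR⟩ := exists_between hW
  have hR0 : 0 < R := (norm_nonneg W).trans_lt hWR
  lift R to NNReal using hR0.le
  have on_ball := ((differentiableOn_altProdLim hZ).mono
    (Metric.closedBall_subset_ball hR)).hasFPowerSeriesOnBall (by exact_mod_cast hR0)
  rw [on_ball.hasFPowerSeriesAt.eq_formalMultilinearSeries near_zero] at on_ball
  have := on_ball.hasSum (y := W) (by rwa [Metric.eball_coe, mem_ball_zero_iff])
  simpa [FormalMultilinearSeries.apply_eq_pow_smul_coeff, mul_comm] using this

end PowerSeries

section EulerProducts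

/-- `sin (π c / 2) / (π c / 2)`, extended by `1` at `c = 0`. -/
noncomputable def sincHalf (c : ℂ) : ℂ :=
  if c = 0 then 1 else Complex.sin (Real.pi * c / 2) / (Real.pi * c / 2)

/-- The partial products of Euler's product `∏ (1 - c² / k²)` over even `k ≥ 1`. -/
noncomputable def evenProd (c : ℂ) (n : ℕ) : ℂ :=
  ∏ j ∈ range n, (1 - c ^ 2 / (2 * (j : ℂ) + 2) ^ 2)

/-- The partial products of Euler's product `∏ (1 - c² / k²)` over odd `k ≥ 1`. -/
noncomputable def oddProd (c : ℂ) (n : ℕ) : ℂ :=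
  ∏ j ∈ range n, (1 - c ^ 2 / (2 * (j : ℂ) + 1) ^ 2)

theorem evenProd_succ (c : ℂ) (n : ℕ) :
    evenProd c (n + 1) = evenProd c n * (1 - c ^ 2 / (2 * (n : ℂ) + 2) ^ 2) :=
  prod_range_succ _ n

theorem oddProd_succ (c : ℂ) (n : ℕ) :
    oddProd c (n + 1) = oddProd c n * (1 - c ^ 2 / (2 * (n : ℂ) + 1) ^ 2) :=
  prod_range_succ _ n

theorem tendsto_evenProd (c : ℂ) : Tendsto (evenProd c) atTop (𝓝 (sincHalf c)) := by
  rcases eq_or_ne c 0 with rfl | hc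
  · refine tendsto_const_nhds.congr fun n => ?_
    simp [evenProd, sincHalf]
  · have hne : (Real.pi : ℂ) * c / 2 ≠ 0 := by simp [Real.pi_ne_zero, hc]
    rw [sincHalf, if_neg hc, mul_div_assoc]
    rw [mul_div_assoc] at hne
    refine ((Complex.tendsto_euler_sin_prod (c / 2)).div_const _).congr fun n => ?_
    rw [mul_div_cancel_left₀ _ hne]
    refine prod_congr rfl fun j _ => ?_
    rw [div_pow, div_div, ← mul_pow, mul_add_one]

theorem evenProd_mul_oddProd (c : ℂ) (n : ℕ) :
    evenProd c n * oddProd c n = evenProd (2 * c) (2 * n) := by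
  induction n with
  | zero => simp [evenProd, oddProd]
  | succ n ih =>
    have halve : ∀ x : ℂ, (2 * c) ^ 2 / (2 * x + 2) ^ 2 = c ^ 2 / (x + 1) ^ 2 := fun x => by
      rw [← mul_add_one, mul_pow, mul_pow, mul_div_mul_left _ _ (by norm_num)]
    rw [evenProd_succ, oddProd_succ, Nat.mul_succ, evenProd_succ, evenProd_succ, ← ih, halve, halve]
    push_cast
    rw [add_assoc (2 * (n : ℂ)), one_add_one_eq_two]
    ring

theorem sincHalf_two_mul (c : ℂ) :
    sincHalf (2 * c) = sincHalf c * Complex.cos (Real.pi * c / 2) := by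
  rcases eq_or_ne c 0 with rfl | hc
  · simp [sincHalf]
  · have hpi : (Real.pi : ℂ) ≠ 0 := Complex.ofReal_ne_zero.mpr Real.pi_ne_zero
    rw [sincHalf, sincHalf, if_neg (by simpa using hc), if_neg hc,
      show (Real.pi : ℂ) * (2 * c) / 2 = 2 * (Real.pi * c / 2) by ring, Complex.sin_two_mul]
    field_simp

theorem tendsto_oddProd {c : ℂ} (hc : sincHalf c ≠ 0) :
    Tendsto (oddProd c) atTop (𝓝 (Complex.cos (Real.pi * c / 2))) := by
  have quotient := ((tendsto_evenProd (2 * c)).comp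
    (tendsto_id.const_mul_atTop' two_pos)).div (tendsto_evenProd c) hc
  rw [sincHalf_two_mul, mul_div_cancel_left₀ _ hc] at quotient
  refine quotient.congr' ?_
  filter_upwards [(tendsto_evenProd c).eventually_ne hc] with n hn
  exact (eq_div_of_mul_eq hn ((mul_comm _ _).trans (evenProd_mul_oddProd c n))).symm

theorem tanQuot_eq (a : ℂ) :
    tanQuot a = Real.pi / 2 * (sincHalf a / Complex.cos (Real.pi * a / 2)) := by
  rcases eq_or_ne a 0 with rfl | ha
  · simp [tanQuot, sincHalf]
  · have hpi : (Real.pi : ℂ) ≠ 0 := Complex.ofReal_ne_zero.mpr Real.pi_ne_zero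
    rw [tanQuot, sincHalf, if_neg ha, if_neg ha, Complex.tan_eq_sin_div_cos]
    field_simp

theorem cotProd_eq (b : ℂ) :
    cotProd b = 2 / Real.pi * (Complex.cos (Real.pi * b / 2) / sincHalf b) := by
  rcases eq_or_ne b 0 with rfl | hb
  · simp [cotProd, sincHalf]
  · have hpi : (Real.pi : ℂ) ≠ 0 := Complex.ofReal_ne_zero.mpr Real.pi_ne_zero
    rw [cotProd, sincHalf, if_neg hb, if_neg hb, Complex.cot_eq_cos_div_sin]
    field_simp

theorem tanQuot_mul_cotProd (a b : ℂ) : tanQuot a * cotProd b =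
    sincHalf a / Complex.cos (Real.pi * a / 2) * (Complex.cos (Real.pi * b / 2) / sincHalf b) := by
  have hpi : (Real.pi : ℂ) ≠ 0 := Complex.ofReal_ne_zero.mpr Real.pi_ne_zero
  rw [tanQuot_eq, cotProd_eq, mul_mul_mul_comm, div_mul_div_cancel₀ two_ne_zero, div_self hpi,
    one_mul]

theorem norm_intCast_sq (k : ℤ) : ‖(k : ℂ) ^ 2‖ = ((k ^ 2 : ℤ) : ℝ) := by
  rw [norm_pow, Complex.norm_intCast, sq_abs, Int.cast_pow]

theorem sincHalf_ne_zero {c : ℂ} (hc : ‖c ^ 2‖ < 4) : sincHalf c ≠ 0 := by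
  rcases eq_or_ne c 0 with rfl | hc0
  · simp [sincHalf]
  · have hpi : (Real.pi : ℂ) ≠ 0 := Complex.ofReal_ne_zero.mpr Real.pi_ne_zero
    rw [sincHalf, if_neg hc0]
    refine div_ne_zero (fun hsin => ?_) (by simp [hpi, hc0])
    obtain ⟨k, hk⟩ := Complex.sin_eq_zero_iff.mp hsin
    have hck : c = ((2 * k : ℤ) : ℂ) := by
      push_cast
      field_simp at hk
      linear_combination hk
    have hk0 : k ≠ 0 := by rintro rfl; exact hc0 (by simpa using hck)
    rw [hck, norm_intCast_sq] at hc
    have hlt : (2 * k) ^ 2 < 4 := by exact_mod_cast hc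
    have : 0 < k ^ 2 := by positivity
    linarith

theorem cos_pi_mul_div_two_ne_zero {c : ℂ} (hc : ‖c ^ 2‖ < 9) (hc1 : c ^ 2 ≠ 1) :
    Complex.cos (Real.pi * c / 2) ≠ 0 := by
  intro hcos
  obtain ⟨k, hk⟩ := Complex.cos_eq_zero_iff.mp hcos
  have hck : c = ((2 * k + 1 : ℤ) : ℂ) := by
    have hpi : (Real.pi : ℂ) ≠ 0 := Complex.ofReal_ne_zero.mpr Real.pi_ne_zero
    push_cast
    field_simp at hk
    linear_combination hk
  rw [hck, norm_intCast_sq] at hc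
  have hlt : (2 * k + 1) ^ 2 < 3 ^ 2 := by exact_mod_cast hc
  have habs := abs_lt.mp (abs_lt_of_sq_lt_sq hlt (by norm_num))
  obtain rfl | rfl : k = 0 ∨ k = -1 := by omega
  all_goals exact hc1 (by rw [hck]; norm_num)

theorem altProd_two_mul_succ (Z W : ℂ) (n : ℕ) :
    altProd Z W (2 * (n + 1)) = altProd Z W (2 * n) *
      (((2 * (n : ℂ) + 1) ^ 2 - (Z - W)) / ((2 * (n : ℂ) + 1) ^ 2 - (Z + W))) *
      (((2 * (n : ℂ) + 2) ^ 2 - (Z + W)) / ((2 * (n : ℂ) + 2) ^ 2 - (Z - W))) := by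
  rw [Nat.mul_succ, altProd, prod_range_succ, prod_range_succ, ← altProd,
    (even_two_mul n).neg_one_pow, (even_two_mul n).add_one.neg_one_pow]
  push_cast
  simp only [one_mul, neg_one_mul, sub_neg_eq_add, ← sub_eq_add_neg, sub_add, sub_sub, add_assoc,
    one_add_one_eq_two, mul_assoc]

theorem altProd_two_mul {Z W a b : ℂ} (ha : a ^ 2 = Z + W) (hb : b ^ 2 = Z - W) (n : ℕ) :
    altProd Z W (2 * n) = evenProd a n / oddProd a n * (oddProd b n / evenProd b n) := by
  induction n with
  | zero => simp [altProd_zero, evenProd, oddProd]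
  | succ n ih =>
    have hodd : (2 * (n : ℂ) + 1) ^ 2 ≠ 0 := by exact_mod_cast pow_ne_zero 2 (2 * n).succ_ne_zero
    have heven : (2 * (n : ℂ) + 2) ^ 2 ≠ 0 := by
      exact_mod_cast pow_ne_zero 2 (2 * n + 1).succ_ne_zero
    have factor : ∀ {m : ℂ}, m ≠ 0 → ∀ x y : ℂ, (m - x) / (m - y) = (1 - x / m) / (1 - y / m) :=
      fun hm x y => by rw [one_sub_div hm, one_sub_div hm, div_div_div_cancel_right₀ hm]
    rw [altProd_two_mul_succ, ih, factor hodd, factor heven, evenProd_succ, oddProd_succ,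
      evenProd_succ, oddProd_succ, ha, hb]
    simp only [div_eq_mul_inv, mul_inv]
    ring

theorem altProdLim_eq {Z W a b : ℂ} (hZ : ‖Z‖ < 1) (hW : ‖W‖ < ‖1 - Z‖)
    (ha : a ^ 2 = Z + W) (hb : b ^ 2 = Z - W) : altProdLim Z W = tanQuot a * cotProd b := by
  have hWZ : ‖Z‖ + ‖W‖ < 3 := by linarith [norm_sub_le 1 Z, norm_one (α := ℂ)]
  have ha3 : ‖a ^ 2‖ < 3 := ha ▸ (norm_add_le _ _).trans_lt hWZ
  have hb3 : ‖b ^ 2‖ < 3 := hb ▸ (norm_sub_le _ _).trans_lt hWZ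
  have ha1 : a ^ 2 ≠ 1 := fun h => hW.ne (by rw [← h, ha, add_sub_cancel_left])
  have hsa : sincHalf a ≠ 0 := sincHalf_ne_zero (by linarith)
  have hsb : sincHalf b ≠ 0 := sincHalf_ne_zero (by linarith)
  have hca := cos_pi_mul_div_two_ne_zero (by linarith) ha1
  rw [tanQuot_mul_cotProd]
  refine tendsto_nhds_unique
    ((tendsto_altProd hZ hW).comp (tendsto_id.const_mul_atTop' two_pos)) ?_
  exact (((tendsto_evenProd a).div (tendsto_oddProd hsa) hca).mul
    ((tendsto_oddProd hsb).div (tendsto_evenProd b) hsb)).congr fun n =>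
      (altProd_two_mul ha hb n).symm

end EulerProducts

section EvenOddTerms

theorem summable_zetaSum_mul_pow_two_mul {z : ℂ} (hz : ‖z ^ 2‖ < 1) (m : ℕ) (c : ℂ) :
    Summable fun n => (zetaSum m n : ℂ) * z ^ (2 * n) * c := by
  simpa only [pow_mul] using (summable_zetaSum_mul_pow hz m).mul_right c

theorem tsum_Zstar0_mul_pow (z w : ℂ) (d : ℕ) :
    ∑' n, (Zstar0 d n : ℂ) * z ^ (2 * n) * w ^ (4 * d) =
      zetaGen (z ^ 2) (2 * d) * (-w ^ 2) ^ (2 * d) := by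
  have hw : w ^ (4 * d) = (-w ^ 2) ^ (2 * d) := by
    rw [(even_two_mul d).neg_pow, ← pow_mul]
    ring
  simp only [hw, ← zetaSum_two_mul, pow_mul z, zetaGen, tsum_mul_right]

theorem tsum_Zstar1_mul_pow (z w : ℂ) (d : ℕ) :
    ∑' n, (Zstar1 d (n + 1) : ℂ) * z ^ (2 * n) * w ^ (4 * d + 2) =
      -(zetaGen (z ^ 2) (2 * d + 1) * (-w ^ 2) ^ (2 * d + 1)) := by
  have hw : w ^ (4 * d + 2) = -(-w ^ 2) ^ (2 * d + 1) := by
    rw [(even_two_mul d).add_one.neg_pow, ← pow_mul]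
    ring
  simp only [hw, ← zetaSum_two_mul_add_one, pow_mul z, zetaGen, tsum_mul_right, mul_neg, tsum_neg]

end EvenOddTerms

theorem theorem4p3_general (z w : ℂ) (hz : ‖z‖ < 1) :
    (∀ d : ℕ, Summable fun n : ℕ => (Zstar0 d n : ℂ) * z ^ (2 * n) * w ^ (4 * d)) ∧
    (∀ d : ℕ, Summable fun n : ℕ => (Zstar1 d (n + 1) : ℂ) * z ^ (2 * n) * w ^ (4 * d + 2)) ∧
    (‖w‖ ^ 2 < ‖1 - z ^ 2‖ →
      (Summable fun d : ℕ => ∑' n : ℕ, (Zstar0 d n : ℂ) * z ^ (2 * n) * w ^ (4 * d)) ∧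
      (Summable fun d : ℕ => ∑' n : ℕ, (Zstar1 d (n + 1) : ℂ) * z ^ (2 * n) * w ^ (4 * d + 2)) ∧
      ∀ a b : ℂ, a ^ 2 = z ^ 2 - w ^ 2 → b ^ 2 = z ^ 2 + w ^ 2 →
        (∑' d : ℕ, ∑' n : ℕ, (Zstar0 d n : ℂ) * z ^ (2 * n) * w ^ (4 * d)) -
          (∑' d : ℕ, ∑' n : ℕ, (Zstar1 d (n + 1) : ℂ) * z ^ (2 * n) * w ^ (4 * d + 2)) =
        tanQuot a * cotProd b) := by
  have hZ : ‖z ^ 2‖ < 1 := by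
    rw [norm_pow]
    exact pow_lt_one₀ (norm_nonneg z) hz two_ne_zero
  refine ⟨fun d => ?_, fun d => ?_, fun hlt => ?_⟩
  · simpa only [zetaSum_two_mul] using summable_zetaSum_mul_pow_two_mul hZ (2 * d) (w ^ (4 * d))
  · simpa only [zetaSum_two_mul_add_one] using
      summable_zetaSum_mul_pow_two_mul hZ (2 * d + 1) (w ^ (4 * d + 2))
  have hW : ‖-w ^ 2‖ < ‖1 - z ^ 2‖ := by rwa [norm_neg, norm_pow]
  have total := hasSum_zetaGen hZ hW
  have even_part := total.summable.comp_injective (i := (2 * ·)) (mul_right_injective₀ two_ne_zero)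
  have odd_part := total.summable.comp_injective (i := (2 * · + 1)) fun _ _ h => by simpa using h
  simp only [tsum_Zstar0_mul_pow, tsum_Zstar1_mul_pow]
  refine ⟨even_part, odd_part.neg, fun a b ha hb => ?_⟩
  rw [tsum_neg, sub_neg_eq_add, ← altProdLim_eq hZ hW (ha.trans (sub_eq_add_neg _ _))
    (hb.trans (sub_neg_eq_add _ _).symm), ← total.tsum_eq]
  exact tsum_even_add_odd (f := fun m => zetaGen (z ^ 2) m * (-w ^ 2) ^ m) even_part odd_part

theorem theorem4p3 (z w : ℂ) (hz : ‖z‖ < 1) (hw : ‖w‖ < 1) :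
    (∀ d : ℕ, Summable fun n : ℕ => (Zstar0 d n : ℂ) * z ^ (2 * n) * w ^ (4 * d)) ∧
    (∀ d : ℕ, Summable fun n : ℕ => (Zstar1 d (n + 1) : ℂ) * z ^ (2 * n) * w ^ (4 * d + 2)) ∧
    (‖w‖ ^ 2 < ‖1 - z ^ 2‖ →
      (Summable fun d : ℕ => ∑' n : ℕ, (Zstar0 d n : ℂ) * z ^ (2 * n) * w ^ (4 * d)) ∧
      (Summable fun d : ℕ => ∑' n : ℕ, (Zstar1 d (n + 1) : ℂ) * z ^ (2 * n) * w ^ (4 * d + 2)) ∧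
      ∀ a b : ℂ, a ^ 2 = z ^ 2 - w ^ 2 → b ^ 2 = z ^ 2 + w ^ 2 →
        (∑' d : ℕ, ∑' n : ℕ, (Zstar0 d n : ℂ) * z ^ (2 * n) * w ^ (4 * d)) -
          (∑' d : ℕ, ∑' n : ℕ, (Zstar1 d (n + 1) : ℂ) * z ^ (2 * n) * w ^ (4 * d + 2)) =
        tanQuot a * cotProd b) :=
  theorem4p3_general z w hz
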